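/- Let $n\ge 2$ and $e>0$ be integers, let $S=\mathbb{C}[x_0,\dots,x_n]$, and let $W:g=0$ be a smooth hypersurface of degree $e$ in $\mathbb{P}^n$, where $g\in S$ is homogeneous of degree $e$. Put $f=x_0x_1\cdots x_n\,g$ and assume that the hypersurface $V:f=0$ is a normal crossing divisor in $\mathbb{P}^n$, i.e. near each of its points $V$ is given by an equation $t_1\cdots t_r=0$, where $t_1,\dots,t_r$ are part of a system of local analytic coordinates centred at that point ($f$ being, in an affine chart, a unit times $t_1\cdots t_r$). Write $f_j,g_j$ for the partial derivatives with respect to $x_j$, set $g'_i=x_ig_i+g$ for $0\le i\le n$, and let $$D_0(f)=\Big\{(a_0,\dots,a_n)\in S^{n+1} : \sum_{j=0}^n a_jf_j=0\Big\}$$ be the graded $S$-module of Jacobian syzygies of $f$. For $0\le i<j\le n$ let $\rho'_{ij}\in S^{n+1}$ be the vector whose $i$-th component is $x_ig'_j$, whose $j$-th component is $-x_jg'_i$, and whose other components are zero. Then each $\rho'_{ij}$ is homogeneous of degree $e+1$ and has exactly two nonzero components (the $i$-th and the $j$-th), and the $\rho'_{ij}$, $0\le i<j\le n$, are $\binom{n+1}{2}$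 distinct elements which form a minimal set of generators of the $S$-module $D_0(f)$: they generate $D_0(f)$, no proper subset of them does, and $D_0(f)$ cannot be generated by fewer than $\binom{n+1}{2}$ elements. -/

import Mathlib

noncomputable section

namespace JacobianSyzygies

open MvPolynomial Topology

/-- The hypersurface `g = 0` in `ℙⁿ` (with `g` homogeneous in the `n + 1` variables) is smooth:
at every point of it some partial derivative of `g` does not vanish. -/
def IsSmoothHypersurface {n : ℕ} (g : MvPolynomial (Fin (n + 1)) ℂ) : Prop :=
  ∀ p : Fin (n + 1) → ℂ, p ≠ 0 → eval p g = 0 → ∃ i, eval p (pderiv i g) ≠ 0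

/-- The functions `t 0, …, t (n - 1)` form a system of local analytic coordinates of `ℂⁿ`
centred at `y`: they are analytic at `y`, vanish at `y`, and their differentials at `y`
are linearly independent. -/
def IsLocalCoordinates {n : ℕ} (t : Fin n → (Fin n → ℂ) → ℂ) (y : Fin n → ℂ) : Prop :=
  (∀ i, AnalyticAt ℂ (t i) y) ∧ (∀ i, t i y = 0) ∧
    LinearIndependent ℂ (fun i => fderiv ℂ (t i) y)

/-- The divisor `F = 0` has normal crossings at `y`: near `y`, the function `F` is a
nowhere vanishing analytic function times a product of distinct members of a system of
local analytic coordinates centred at `y`. -/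
def IsNormalCrossingAt {n : ℕ} (F : (Fin n → ℂ) → ℂ) (y : Fin n → ℂ) : Prop :=
  ∃ (t : Fin n → (Fin n → ℂ) → ℂ) (s : Finset (Fin n)) (u : (Fin n → ℂ) → ℂ),
    IsLocalCoordinates t y ∧ AnalyticAt ℂ u y ∧ u y ≠ 0 ∧
      ∀ᶠ z in 𝓝 y, F z = u z * ∏ i ∈ s, t i z

/-- The restriction of `f` to the standard affine chart `x_k = 1` of `ℙⁿ`, as a function
on `ℂⁿ`. -/
def affineChart {n : ℕ} (f : MvPolynomial (Fin (n + 1)) ℂ) (k : Fin (n + 1))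
    (y : Fin n → ℂ) : ℂ :=
  eval (k.insertNth 1 y : Fin (n + 1) → ℂ) f

/-- The hypersurface `f = 0` in `ℙⁿ` (with `f` homogeneous) is a normal crossing divisor:
it has normal crossings at each of its points, tested in the standard affine charts. -/
def IsNormalCrossingDivisor {n : ℕ} (f : MvPolynomial (Fin (n + 1)) ℂ) : Prop :=
  ∀ (k : Fin (n + 1)) (y : Fin n → ℂ), affineChart f k y = 0 →
    IsNormalCrossingAt (affineChart f k) y

/-- The module `D₀(f)` of Jacobian syzygies of `f`. -/
def D₀ {n : ℕ} (f : MvPolynomial (Fin (n + 1)) ℂ) :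
    Submodule (MvPolynomial (Fin (n + 1)) ℂ) (Fin (n + 1) → MvPolynomial (Fin (n + 1)) ℂ) where
  carrier := {a | ∑ j, a j * pderiv j f = 0}
  zero_mem' := by simp
  add_mem' := by
    intro a b ha hb
    simp only [Set.mem_ofPred_eq, Pi.add_apply, add_mul, Finset.sum_add_distrib] at *
    rw [ha, hb, add_zero]
  smul_mem' := by
    intro c a ha
    simp only [Set.mem_ofPred_eq, Pi.smul_apply, smul_eq_mul, mul_assoc, ← Finset.mul_sum] at *
    rw [ha, mul_zero]

/-- `g'_i = x_i g_i + g`, where `g_i` is the `i`-th partial derivative of `g`. -/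
def gPrime {n : ℕ} (g : MvPolynomial (Fin (n + 1)) ℂ) (i : Fin (n + 1)) :
    MvPolynomial (Fin (n + 1)) ℂ :=
  X i * pderiv i g + g

/-- `ρ'_{ij}`: the `i`-th component is `x_i g'_j`, the `j`-th component is `-x_j g'_i`, and
the other components are zero. -/
def rhoPrime {n : ℕ} (g : MvPolynomial (Fin (n + 1)) ℂ) (i j : Fin (n + 1)) :
    Fin (n + 1) → MvPolynomial (Fin (n + 1)) ℂ :=
  fun k => if k = i then X i * gPrime g j else if k = j then -(X j * gPrime g i) else 0

/-- `X` is a minimal set of generators of the submodule `N`: it generates `N` and no proper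
subset of it does. -/
def IsMinimalGenerators {R M : Type*} [Semiring R] [AddCommMonoid M] [Module R M]
    (X : Set M) (N : Submodule R M) : Prop :=
  Minimal (fun Y : Set M => Submodule.span R Y = N) X

end JacobianSyzygies

end

/-!
If `p ≠ 0` lies on `V`, then in an affine chart centred at `p` the function `x_0 ⋯ x_n g` is a unit
times a product of some of the coordinates `x_j` and possibly `g`, and also a unit times
`t_1 ⋯ t_r`. Comparing leading forms, the product of the differentials of the first factors is a
multiple of `dt_1 ⋯ dt_r`, so these differentials are again linearly independent. A common zero of
the `g'_i = x_i g_i + g` would be a zero of `g` at which `dg` is a combination of the `dx_j` with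
`x_j = 0`; hence `g'_0, …, g'_n` vanish together only at the origin.

Such a sequence has only Koszul syzygies: by the Nullstellensatz a prime containing all the `g'_i`
is the ideal of the variables, so the vanishing of `Ext` below the depth of the polynomial ring
supplies a combination of the `g'_i` regular on it, and one passes to the quotient by this
combination with one element less.

In a Jacobian syzygy `(a_j)` of `x_0 ⋯ x_n g` each `a_j` is divisible by `x_j`, as `x_j` does not
divide `g'_j`, and `(a_j / x_j)` is a syzygy of `(g'_j)`; the Koszul relations of the `g'_j` become
the `ρ'_{ij}`. Finally, the `ρ'_{ij}` have the same degree and are linearly independent over `ℂ`,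
so a linear algebra argument in degree `e + 1` shows that no smaller set generates.
-/

noncomputable section

namespace JacobianSyzygies

open MvPolynomial Topology Pointwise

section Koszul

variable {R M ι : Type*} [CommRing R] [AddCommGroup M] [Module R M]

/-- The module of syzygies of the family `h` with coefficients in `M`. -/
def syzygies [Fintype ι] (h : ι → R) (M : Type*) [AddCommGroup M] [Module R M] :
    Submodule R (ι → M) :=
  LinearMap.ker (∑ i, h i • LinearMap.proj i : (ι → M) →ₗ[R] M)

lemma mem_syzygies_iff [Fintype ι] {h : ι → R} {b : ι → M} :
    b ∈ syzygies h M ↔ ∑ i, h i • b i = 0 := by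
  simp [syzygies]

variable [DecidableEq ι]

/-- The Koszul relation with coefficient `m` between the members `i` and `j` of the family `h`. -/
def koszulRelation (h : ι → R) (i j : ι) (m : M) : ι → M :=
  Pi.single i (h j • m) - Pi.single j (h i • m)

/-- The submodule generated by the Koszul relations of the family `h`, i.e. the image of the second
differential of the Koszul complex of `h` with coefficients in `M`. -/
def koszulSubmodule (h : ι → R) (M : Type*) [AddCommGroup M] [Module R M] :
    Submodule R (ι → M) :=
  Submodule.span R {b | ∃ i j m, koszulRelation h i j m = b}

lemma koszulRelation_mem_koszulSubmodule (h : ι → R) (i j : ι) (m : M) :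
    koszulRelation h i j m ∈ koszulSubmodule h M :=
  Submodule.subset_span ⟨i, j, m, rfl⟩

lemma koszulSubmodule_le_syzygies [Fintype ι] (h : ι → R) :
    koszulSubmodule h M ≤ syzygies h M := by
  rw [koszulSubmodule, Submodule.span_le]
  rintro _ ⟨i, j, m, rfl⟩
  rw [SetLike.mem_coe, mem_syzygies_iff]
  simp [koszulRelation, smul_sub, Pi.single_apply, Finset.sum_sub_distrib,
    smul_comm (h i) (h j) m]

lemma map_compLeft_koszulSubmodule {M' : Type*} [AddCommGroup M'] [Module R M'] (h : ι → R)
    {π : M →ₗ[R] M'} (hπ : Function.Surjective π) :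
    (koszulSubmodule h M).map (π.compLeft ι) = koszulSubmodule h M' := by
  have hmap (i j : ι) (m : M) :
      π.compLeft ι (koszulRelation h i j m) = koszulRelation h i j (π m) := by
    funext k
    simp [koszulRelation, Pi.single_apply, apply_ite π]
  rw [koszulSubmodule, Submodule.map_span, koszulSubmodule]
  congr 1
  ext b
  constructor
  · rintro ⟨_, ⟨i, j, m, rfl⟩, rfl⟩
    exact ⟨i, j, π m, (hmap i j m).symm⟩
  · rintro ⟨i, j, m, rfl⟩
    obtain ⟨m, rfl⟩ := hπ m
    exact ⟨_, ⟨i, j, m, rfl⟩, hmap i j m⟩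

lemma smul_sub_smul_mem_koszulSubmodule [Fintype ι] (h v : ι → R) (a : ι → M) :
    (∑ j, v j * h j) • a - (fun j => v j • ∑ i, h i • a i) ∈ koszulSubmodule h M := by
  have key : (∑ j, v j * h j) • a - (fun j => v j • ∑ i, h i • a i) =
      ∑ i, ∑ j, v j • koszulRelation h i j (a i) := by
    funext k
    simp [koszulRelation, Finset.sum_apply, Pi.single_apply, smul_sub, Finset.sum_sub_distrib,
      Finset.sum_smul, Finset.smul_sum, mul_smul]
  rw [key]
  exact Submodule.sum_mem _ fun i _ => Submodule.sum_mem _ fun j _ =>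
    Submodule.smul_mem _ _ (koszulRelation_mem_koszulSubmodule h i j _)

lemma mem_koszulSubmodule_of_mkQ_compLeft_mem [Fintype ι] {h v : ι → R} {c : R}
    (hc : ∑ i, v i * h i = c) (hreg : IsSMulRegular M c) {b : ι → M} (hb : b ∈ syzygies h M)
    {m : M} (hbm : (c • ⊤ : Submodule R M).mkQ.compLeft ι (b - fun i => v i • m) ∈
      koszulSubmodule h (QuotSMulTop c M)) : b ∈ koszulSubmodule h M := by
  obtain ⟨z, hz, hzb⟩ :
      (c • ⊤ : Submodule R M).mkQ.compLeft ι (b - fun i => v i • m) ∈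
        (koszulSubmodule h M).map ((c • ⊤ : Submodule R M).mkQ.compLeft ι) := by
    rwa [map_compLeft_koszulSubmodule h (Submodule.mkQ_surjective _)]
  have hquot (i : ι) : ∃ a : M, c • a = b i - v i • m - z i := by
    simpa [Submodule.mem_smul_pointwise_iff_exists] using
      (Submodule.Quotient.eq _).1 (congrFun hzb i).symm
  choose a ha using hquot
  set m' := m + ∑ i, h i • a i with hm'
  have hbm' : b - (fun i => v i • m') ∈ koszulSubmodule h M := by
    convert add_mem hz (smul_sub_smul_mem_koszulSubmodule h v a) using 1
    funext i
    simp only [Pi.sub_apply, Pi.add_apply, Pi.smul_apply, hc, ha, hm', smul_add]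
    abel
  -- Since `b` and the Koszul relations are syzygies, so is `v • m'`, which says `c • m' = 0`.
  have hm'0 : m' = 0 := by
    have hsyz := koszulSubmodule_le_syzygies h hbm'
    rw [mem_syzygies_iff] at hsyz hb
    refine hreg.right_eq_zero_of_smul ?_
    simpa [smul_sub, Finset.sum_sub_distrib, hb, ← hc, Finset.sum_smul, mul_smul,
      smul_comm (h _) (v _) m'] using hsyz
  have hvm' : (fun i => v i • m') = 0 := by simp [hm'0, Pi.zero_def]
  rwa [hvm', sub_zero] at hbm'

/-- Every syzygy with coefficients in `M` of the members of `h` indexed by `s` is a combination of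
Koszul relations; these are allowed to involve members of `h` with index outside `s`. -/
def HasKoszulSyzygies [Fintype ι] (h : ι → R) (s : Finset ι) (M : Type*) [AddCommGroup M]
    [Module R M] : Prop :=
  ∀ b ∈ syzygies h M, (∀ i ∉ s, b i = 0) → b ∈ koszulSubmodule h M

lemma HasKoszulSyzygies.of_quotSMulTop [Fintype ι] {h v : ι → R} {c : R} {s : Finset ι} {k : ι}
    (hv : ∀ i ∉ s, v i = 0) (hvk : IsUnit (v k)) (hc : ∑ i, v i * h i = c)
    (hreg : IsSMulRegular M c) (H : HasKoszulSyzygies h (s.erase k) (QuotSMulTop c M)) :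
    HasKoszulSyzygies h s M := by
  intro b hb hbs
  obtain ⟨u, hu⟩ := hvk
  set m : M := (↑u⁻¹ : R) • b k with hm
  refine mem_koszulSubmodule_of_mkQ_compLeft_mem hc hreg hb (m := m) (H _ ?_ fun i hi => ?_)
  · rw [mem_syzygies_iff] at hb ⊢
    have hsum : ∑ i, h i • (b i - v i • m) = -(c • m) := by
      simp [smul_sub, Finset.sum_sub_distrib, hb, ← hc, Finset.sum_smul, mul_smul,
        smul_comm (h _) (v _) m]
    have hzero : (c • ⊤ : Submodule R M).mkQ (-(c • m)) = 0 :=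
      (Submodule.Quotient.mk_eq_zero _).2
        (neg_mem (Submodule.smul_mem_pointwise_smul m c ⊤ trivial))
    simpa [← hsum] using hzero
  · suffices b i - v i • m = 0 by simp [this]
    by_cases hik : i = k
    · rw [hik, ← hu, hm, smul_smul, Units.mul_inv, one_smul, sub_self]
    · have his : i ∉ s := fun his => hi (Finset.mem_erase.2 ⟨hik, his⟩)
      rw [hbs i his, hv i his, zero_smul, sub_zero]

end Koszul

section KoszulOfRing

variable {K R ι : Type*} [CommRing R]

lemma apply_mem_of_mem_koszulSubmodule [DecidableEq ι] {I : Ideal R} {h : ι → R}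
    (hI : ∀ i, h i ∈ I) {b : ι → R} (hb : b ∈ koszulSubmodule h R) (k : ι) : b k ∈ I := by
  suffices koszulSubmodule h R ≤ Submodule.comap (LinearMap.proj k : (ι → R) →ₗ[R] R) I from this hb
  rw [koszulSubmodule, Submodule.span_le]
  rintro _ ⟨i, j, m, rfl⟩
  refine I.sub_mem ?_ ?_ <;> rw [Pi.single_apply] <;> split_ifs
  exacts [I.mul_mem_right m (hI j), I.zero_mem, I.mul_mem_right m (hI i), I.zero_mem]

lemma linearIndependent_of_syzygies_eq_koszulSubmodule [Field K] [Algebra K R] [Fintype ι]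
    [DecidableEq ι] {I : Ideal R} (hI : I ≠ ⊤) {h : ι → R} (hh : ∀ i, h i ∈ I)
    (hK : syzygies h R = koszulSubmodule h R) : LinearIndependent K h := by
  refine Fintype.linearIndependent_iff.2 fun c hc i => by_contra fun hci => hI ?_
  have hsyz : (fun i => algebraMap K R (c i)) ∈ syzygies h R := by
    rw [mem_syzygies_iff, ← hc]
    exact Finset.sum_congr rfl fun j _ => by rw [smul_eq_mul, Algebra.smul_def, mul_comm]
  exact I.eq_top_of_isUnit_mem (apply_mem_of_mem_koszulSubmodule hh (hK ▸ hsyz) i)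
    ((IsUnit.mk0 _ hci).map (algebraMap K R))

variable [LinearOrder ι]

lemma koszulSubmodule_eq_span_range (h : ι → R) :
    koszulSubmodule h R = Submodule.span R
      (Set.range fun p : {p : ι × ι // p.1 < p.2} => koszulRelation h p.1.1 p.1.2 (1 : R)) := by
  refine le_antisymm (Submodule.span_le.2 ?_) (Submodule.span_le.2 ?_)
  · rintro _ ⟨i, j, m, rfl⟩
    have hsmul : koszulRelation h i j m = m • koszulRelation h i j (1 : R) := by
      funext k
      simp [koszulRelation, Pi.single_apply, mul_sub, mul_comm]
    rw [SetLike.mem_coe, hsmul]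
    refine Submodule.smul_mem _ _ ?_
    rcases lt_trichotomy i j with hij | rfl | hji
    · exact Submodule.subset_span ⟨⟨(i, j), hij⟩, rfl⟩
    · simp [koszulRelation]
    · rw [show koszulRelation h i j (1 : R) = -koszulRelation h j i 1 from (neg_sub _ _).symm]
      exact neg_mem (Submodule.subset_span ⟨⟨(j, i), hji⟩, rfl⟩)
  · rintro _ ⟨p, rfl⟩
    exact koszulRelation_mem_koszulSubmodule h _ _ _

lemma linearIndependent_koszulRelation [Field K] [Algebra K R] {h : ι → R}
    (hh : LinearIndependent K h) : LinearIndependent K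
      fun p : {p : ι × ι // p.1 < p.2} => koszulRelation h p.1.1 p.1.2 (1 : R) := by
  obtain ⟨φ, hφ⟩ := (Finsupp.linearCombination K h).exists_leftInverse_of_injective
    (LinearMap.ker_eq_bot.2 hh)
  have hφh (i : ι) : φ (h i) = Finsupp.single i 1 := by
    simpa using LinearMap.congr_fun hφ (Finsupp.single i 1)
  have hcoord (p q : {p : ι × ι // p.1 < p.2}) :
      φ (koszulRelation h q.1.1 q.1.2 (1 : R) p.1.1) p.1.2 = if p = q then 1 else 0 := by
    obtain ⟨⟨i, j⟩, hij : i < j⟩ := p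
    obtain ⟨⟨k, l⟩, hkl : k < l⟩ := q
    by_cases hik : i = k
    · subst hik
      simp [koszulRelation, hkl.ne, hφh, Finsupp.single_apply, eq_comm]
    · have hkj : i = l → k ≠ j := by
        rintro rfl rfl
        exact hij.asymm hkl
      by_cases hil : i = l
      · subst hil
        simp [koszulRelation, hik, hφh, hkj rfl]
      · simp [koszulRelation, hik, hil]
  exact LinearIndependent.of_pairwise_dual_eq_zero_one _
    (fun p => Finsupp.lapply p.1.2 ∘ₗ φ ∘ₗ LinearMap.proj p.1.1)
    (fun p q hpq => by simp [hcoord, hpq]) fun p => by simp [hcoord]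

end KoszulOfRing

section Depth

universe u

open CategoryTheory Abelian PrimeSpectrum

lemma exists_mem_isSMulRegular {K R M : Type*} [Field K] [Infinite K] [CommRing R]
    [IsNoetherianRing R] [Algebra K R] [AddCommGroup M] [Module R M] [Module.Finite R M]
    (V : Submodule K R) (hV : ∀ p ∈ associatedPrimes R M, ¬ V ≤ p.restrictScalars K) :
    ∃ x ∈ V, IsSMulRegular M x := by
  have : Finite (associatedPrimes R M) := (associatedPrimes.finite R M).to_subtype
  obtain ⟨x, hx⟩ := Submodule.exists_forall_notMem_of_forall_ne_top
    (fun p : associatedPrimes R M => (p.1.restrictScalars K).comap V.subtype)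
    fun p => mt Submodule.comap_subtype_eq_top.1 (hV p.1 p.2)
  refine ⟨x, x.2, by_contra fun hreg => ?_⟩
  have hzero : (x : R) ∈ ⋃ p ∈ associatedPrimes R M, (p : Set R) := by
    rw [biUnion_associatedPrimes_eq_compl_regular R M]
    exact hreg
  obtain ⟨p, hp, hxp⟩ := Set.mem_iUnion₂.1 hzero
  exact hx ⟨p, hp⟩ hxp

lemma notMem_associatedPrimes_of_annihilator_le {R N M : Type*} [CommRing R] [IsNoetherianRing R]
    [AddCommGroup N] [Module R N] [Module.Finite R N] [AddCommGroup M] [Module R M]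
    [Module.Finite R M] [Subsingleton (N →ₗ[R] M)] {p : Ideal R}
    (hp : Module.annihilator R N ≤ p) : p ∉ associatedPrimes R M := by
  intro hass
  obtain ⟨x, hxN, hx⟩ := IsSMulRegular.subsingleton_linearMap_iff.1 ‹Subsingleton (N →ₗ[R] M)›
  have hzero : x ∈ ⋃ p ∈ associatedPrimes R M, (p : Set R) := Set.mem_biUnion hass (hp hxN)
  rw [biUnion_associatedPrimes_eq_compl_regular R M] at hzero
  exact hzero hx

lemma subsingleton_ext_quotSMulTop {R : Type u} [CommRing R] (N M : ModuleCat.{u} R) {x : R}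
    (hx : IsSMulRegular M x) {r : ℕ} (hext : ∀ i < r + 1, Subsingleton (Ext N M i)) {i : ℕ}
    (hi : i < r) : Subsingleton (Ext N (ModuleCat.of R (QuotSMulTop x M)) i) :=
  have hi₀ := AddCommGrpCat.isZero_of_iff_subsingleton.mpr (hext i (by omega))
  have hi₁ := AddCommGrpCat.isZero_of_iff_subsingleton.mpr (hext (i + 1) (by omega))
  AddCommGrpCat.subsingleton_of_isZero <| ShortComplex.Exact.isZero_of_both_zeros
    ((Ext.covariant_sequence_exact₃' N hx.smulShortComplex_shortExact) i (i + 1) rfl)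
    (hi₀.eq_zero_of_src _) (hi₁.eq_zero_of_tgt _)

variable {K ι : Type*} {R : Type u} [Field K] [CommRing R] [Algebra K R] [Fintype ι]

lemma exists_isSMulRegular_sum [Infinite K] [IsNoetherianRing R] {N M : Type*} [AddCommGroup N]
    [Module R N] [Module.Finite R N] [AddCommGroup M] [Module R M] [Module.Finite R M]
    [Subsingleton (N →ₗ[R] M)] {h : ι → R} {s : Finset ι}
    (hsupp : Module.support R M ∩ zeroLocus (h '' s) ⊆ Module.support R N) :
    ∃ v : ι → K, (∀ i ∉ s, v i = 0) ∧ IsSMulRegular M (∑ i, algebraMap K R (v i) * h i) := by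
  classical
  obtain ⟨x, hxV, hx⟩ := exists_mem_isSMulRegular (M := M) (Submodule.span K (h '' s))
    fun p hp hle => by
      have hpM : (⟨p, hp.isPrime⟩ : PrimeSpectrum R) ∈ Module.support R M :=
        Module.mem_support_iff_of_finite.2 <|
          Submodule.annihilator_top (R := R) (M := M) ▸ hp.annihilator_le
      exact notMem_associatedPrimes_of_annihilator_le (Module.mem_support_iff_of_finite.1
        (hsupp ⟨hpM, fun _ hy => hle (Submodule.subset_span hy)⟩)) hp
  obtain ⟨c, rfl⟩ := (Submodule.mem_span_image_finset_iff_exists_fun' K).1 hxV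
  refine ⟨fun i => if i ∈ s then c i else 0, by simp +contextual, ?_⟩
  convert hx using 1
  simp [Algebra.smul_def, apply_ite (algebraMap K R)]

variable [DecidableEq ι]

lemma mem_of_sum_mem_of_forall_mem_erase {p : Ideal R} {h : ι → R} {v : ι → K} {s : Finset ι}
    {k : ι} (hv : ∀ i ∉ s, v i = 0) (hvk : v k ≠ 0) (hs : ∀ i ∈ s.erase k, h i ∈ p)
    (hsum : ∑ i, algebraMap K R (v i) * h i ∈ p) : h k ∈ p := by
  have hrest : ∑ i ∈ Finset.univ.erase k, algebraMap K R (v i) * h i ∈ p := by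
    refine p.sum_mem fun i hi => ?_
    by_cases his : i ∈ s
    · exact p.mul_mem_left _ (hs i (Finset.mem_erase.2 ⟨Finset.ne_of_mem_erase hi, his⟩))
    · simp [hv i his]
  rw [← Finset.add_sum_erase _ _ (Finset.mem_univ k), p.add_mem_iff_left hrest] at hsum
  exact (p.unit_mul_mem_iff_mem ((IsUnit.mk0 _ hvk).map (algebraMap K R))).1 hsum

lemma support_quotSMulTop_inter_zeroLocus_subset {M : Type*} [AddCommGroup M] [Module R M]
    [Module.Finite R M] {h : ι → R} {v : ι → K} {s : Finset ι} {k : ι}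
    (hv : ∀ i ∉ s, v i = 0) (hvk : v k ≠ 0) :
    Module.support R (QuotSMulTop (∑ i, algebraMap K R (v i) * h i) M) ∩
      zeroLocus (h '' (s.erase k)) ⊆ Module.support R M ∩ zeroLocus (h '' s) := by
  rintro p ⟨hpM, hph⟩
  rw [Module.support_quotSMulTop] at hpM
  refine ⟨hpM.1, Set.image_subset_iff.2 fun i hi => ?_⟩
  have hmem (j : ι) (hj : j ∈ s.erase k) : h j ∈ p.asIdeal := hph ⟨j, hj, rfl⟩
  by_cases hik : i = k
  · rw [hik]
    exact mem_of_sum_mem_of_forall_mem_erase hv hvk hmem (hpM.2 rfl)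
  · exact hmem i (Finset.mem_erase.2 ⟨hik, hi⟩)

variable (K) in
theorem hasKoszulSyzygies_of_subsingleton_ext [Infinite K] [IsNoetherianRing R]
    (N : ModuleCat.{u} R) [Module.Finite R N] (h : ι → R) (s : Finset ι)
    (M : ModuleCat.{u} R) [Module.Finite R M]
    (hsupp : Module.support R M ∩ zeroLocus (h '' s) ⊆ Module.support R N)
    (hext : ∀ i < s.card, Subsingleton (Ext N M i)) : HasKoszulSyzygies h s M := by
  induction hr : s.card generalizing s M with
  | zero =>
    intro b _ hb
    rw [show b = 0 from funext fun i => hb i (by simp [Finset.card_eq_zero.1 hr])]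
    exact zero_mem _
  | succ r ih =>
    rw [hr] at hext
    have : Subsingleton (N ⟶ M) := Ext.addEquiv₀.subsingleton_congr.1 (hext 0 r.zero_lt_succ)
    have : Subsingleton (N →ₗ[R] M) := ModuleCat.homAddEquiv.symm.subsingleton
    obtain ⟨v, hvs, hreg⟩ := exists_isSMulRegular_sum (K := K) hsupp
    rcases subsingleton_or_nontrivial M with hM | hM
    · exact fun b _ _ => Subsingleton.elim 0 b ▸ zero_mem _
    obtain ⟨k, hk⟩ : ∃ k, v k ≠ 0 := by
      by_contra! hv
      exact IsSMulRegular.not_zero (by simpa [hv] using hreg)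
    have hcard : (s.erase k).card = r := by
      rw [Finset.card_erase_of_mem (not_imp_comm.1 (hvs k) hk), hr, Nat.add_sub_cancel]
    refine HasKoszulSyzygies.of_quotSMulTop (v := fun i => algebraMap K R (v i))
      (fun i hi => by simp [hvs i hi]) ((IsUnit.mk0 _ hk).map _) rfl hreg
      (ih (s.erase k) (ModuleCat.of R (QuotSMulTop _ M))
        ((support_quotSMulTop_inter_zeroLocus_subset hvs hk).trans hsupp)
        (fun i hi => subsingleton_ext_quotSMulTop N M hreg hext (hcard ▸ hi)) hcard)

end Depth

section PolynomialRing

universe u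

variable {n : ℕ}

lemma ofList_take_ofFn_X (R : Type*) [CommRing R] (i : ℕ) :
    Ideal.ofList ((List.ofFn fun j : Fin n => (X j : MvPolynomial (Fin n) R)).take i) =
      Ideal.span (X '' {j : Fin n | (j : ℕ) < i}) := by
  refine congrArg _ (Set.ext fun p => ?_)
  simp only [Set.mem_ofPred_eq, List.mem_take_iff_getElem, List.getElem_ofFn, Set.mem_image]
  constructor
  · rintro ⟨j, hj, rfl⟩
    simp only [List.length_ofFn, lt_inf_iff] at hj
    exact ⟨⟨j, hj.2⟩, hj.1, rfl⟩
  · rintro ⟨j, hj, rfl⟩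
    exact ⟨j, by simp [hj], rfl⟩

lemma isRegular_ofFn_X (R : Type*) [CommRing R] [Nontrivial R] :
    RingTheory.Sequence.IsRegular (MvPolynomial (Fin n) R)
      (List.ofFn fun j : Fin n => (X j : MvPolynomial (Fin n) R)) := by
  refine ⟨⟨fun i hi => ?_⟩, fun htop => ?_⟩
  · rw [ofList_take_ofFn_X, isSMulRegular_quotient_iff_mem_of_smul_mem]
    simp only [smul_eq_mul, Ideal.mul_top, List.getElem_ofFn, mem_ideal_span_X_image]
    rw [List.length_ofFn] at hi
    intro p hp m hm
    obtain ⟨j, hji, hj⟩ := hp (Finsupp.single ⟨i, hi⟩ 1 + m) <| by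
      rwa [mem_support_iff, coeff_X_mul, ← mem_support_iff]
    have hij : (⟨i, hi⟩ : Fin n) ≠ j := (show j < ⟨i, hi⟩ from hji).ne'
    exact ⟨j, hji, by simpa [Finsupp.single_apply, hij] using hj⟩
  · have hone : (1 : MvPolynomial (Fin n) R) ∈
        Ideal.span (X '' {j : Fin n | (j : ℕ) < n}) := by
      rw [← ofList_take_ofFn_X, List.take_of_length_le (by simp), ← Ideal.mul_top (Ideal.ofList _),
        ← smul_eq_mul, ← htop]
      trivial
    obtain ⟨j, -, hj⟩ := mem_ideal_span_X_image.1 hone 0 (by simp)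
    exact hj rfl

variable {K : Type u} [Field K] [IsAlgClosed K]

lemma idealOfVars_le_of_forall_mem {ι : Type*} {σ : Type*} [Finite σ] {h : ι → MvPolynomial σ K}
    (hz : ∀ x : σ → K, (∀ i, eval x (h i) = 0) → x = 0) {p : Ideal (MvPolynomial σ K)}
    [p.IsPrime] (hp : ∀ i, h i ∈ p) : idealOfVars σ K ≤ p := by
  rw [idealOfVars, Ideal.span_le]
  rintro _ ⟨i, rfl⟩
  rw [← IsPrime.vanishingIdeal_zeroLocus (K := K) p, SetLike.mem_coe, mem_vanishingIdeal_iff]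
  intro x hx
  have hx₀ : x = 0 := hz x fun i => by
    simpa [aeval_eq_eval] using mem_zeroLocus_iff.1 hx _ (hp i)
  simp [hx₀]

theorem hasKoszulSyzygies_of_eval_eq_zero (h : Fin n → MvPolynomial (Fin n) K)
    (hz : ∀ x : Fin n → K, (∀ i, eval x (h i) = 0) → x = 0) :
    HasKoszulSyzygies h Finset.univ (MvPolynomial (Fin n) K) := by
  have : Infinite K := IsAlgClosed.instInfinite
  let N : ModuleCat.{u} (MvPolynomial (Fin n) K) :=
    ModuleCat.of _ (MvPolynomial (Fin n) K ⧸ idealOfVars (Fin n) K)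
  have hann : Module.annihilator (MvPolynomial (Fin n) K) N = idealOfVars (Fin n) K :=
    Ideal.annihilator_quotient
  have hreg := isRegular_ofFn_X (n := n) K
  have hvars : Ideal.ofList (List.ofFn fun i : Fin n => (X i : MvPolynomial (Fin n) K)) =
      idealOfVars (Fin n) K :=
    congrArg _ (Set.ext fun _ => List.mem_ofFn' _ _)
  have hext := ModuleCat.subsingleton_ext_of_exists_isRegular (idealOfVars (Fin n) K) N
    (by rw [Module.support_eq_zeroLocus, hann]) (ModuleCat.of _ (MvPolynomial (Fin n) K))
    (lt_top_iff_ne_top.2 fun h => hreg.top_ne_smul (hvars ▸ h.symm)) _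
    (fun f hf => hvars ▸ Ideal.subset_span hf) hreg
  refine hasKoszulSyzygies_of_subsingleton_ext K N h Finset.univ
    (ModuleCat.of _ (MvPolynomial (Fin n) K)) ?_ (by simpa using hext)
  rintro p ⟨-, hp⟩
  rw [Module.mem_support_iff_of_finite, hann]
  exact idealOfVars_le_of_forall_mem hz fun i => hp ⟨i, by simp, rfl⟩

theorem syzygies_eq_koszulSubmodule_of_eval_eq_zero (h : Fin n → MvPolynomial (Fin n) K)
    (hz : ∀ x : Fin n → K, (∀ i, eval x (h i) = 0) → x = 0) :
    syzygies h (MvPolynomial (Fin n) K) = koszulSubmodule h (MvPolynomial (Fin n) K) :=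
  le_antisymm (fun b hb => hasKoszulSyzygies_of_eval_eq_zero h hz b hb (by simp))
    (koszulSubmodule_le_syzygies h)

end PolynomialRing

section LeadingForm

open Filter

lemma linearIndependent_of_forall_exists_apply_eq_zero {K V α β : Type*} [Field K] [Infinite K]
    [AddCommGroup V] [Module K V] [Fintype α] [Fintype β] {l : α → Module.Dual K V}
    {τ : β → Module.Dual K V} (hτ : LinearIndependent K τ) (hl : ∀ a, l a ≠ 0)
    (hcard : Fintype.card α ≤ Fintype.card β) (h : ∀ b v, τ b v = 0 → ∃ a, l a v = 0) :
    LinearIndependent K l := by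
  have hmem (b : β) : τ b ∈ Submodule.span K (Set.range l) := by
    obtain ⟨a, ha⟩ : ∃ a, ∀ v : LinearMap.ker (τ b), l a v = 0 := by
      by_contra! hne
      obtain ⟨v, hv⟩ := Module.Dual.exists_forall_ne_zero_of_forall_exists
        (fun a => l a ∘ₗ (LinearMap.ker (τ b)).subtype) hne
      obtain ⟨a, ha⟩ := h b v v.2
      exact hv a ha
    obtain ⟨c, hc⟩ : ∃ c : K, c • τ b = l a := by
      have hle : ⨅ _ : Unit, LinearMap.ker (τ b) ≤ LinearMap.ker (l a) :=
        iInf_const.le.trans fun v hv => ha ⟨v, hv⟩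
      simpa [Submodule.mem_span_singleton] using mem_span_of_iInf_ker_le_ker hle
    have hc₀ : c ≠ 0 := by
      rintro rfl
      exact hl a (by rw [← hc, zero_smul])
    rw [← inv_smul_smul₀ hc₀ (τ b), hc]
    exact Submodule.smul_mem _ _ (Submodule.subset_span ⟨a, rfl⟩)
  have : FiniteDimensional K (Submodule.span K (Set.range l)) :=
    FiniteDimensional.span_of_finite K (Set.finite_range l)
  rw [linearIndependent_iff_card_le_finrank_span]
  calc Fintype.card α ≤ Fintype.card β := hcard
    _ = Module.finrank K (Submodule.span K (Set.range τ)) := (finrank_span_eq_card hτ).symm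
    _ ≤ Module.finrank K (Submodule.span K (Set.range l)) :=
      Submodule.finrank_mono (Submodule.span_le.2 (Set.range_subset_iff.2 hmem))

variable {𝕜 E : Type*} [NontriviallyNormedField 𝕜] [NormedAddCommGroup E] [NormedSpace 𝕜 E]

lemma tendsto_add_smul_nhdsNE (y v : E) : Tendsto (fun ε : 𝕜 => y + ε • v) (𝓝[≠] 0) (𝓝 y) := by
  have hcont : Continuous fun ε : 𝕜 => y + ε • v := by fun_prop
  simpa using (hcont.tendsto 0).mono_left nhdsWithin_le_nhds

lemma tendsto_mul_prod_div_pow {α : Type*} [Fintype α] {q : α → E → 𝕜} {l : α → E →L[𝕜] 𝕜}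
    {u : E → 𝕜} {y : E} (hu : ContinuousAt u y) (hq : ∀ a, HasFDerivAt (q a) (l a) y)
    (hq₀ : ∀ a, q a y = 0) (v : E) :
    Tendsto (fun ε : 𝕜 => (u (y + ε • v) * ∏ a, q a (y + ε • v)) / ε ^ Fintype.card α) (𝓝[≠] 0)
      (𝓝 (u y * ∏ a, l a v)) := by
  have hprod : Tendsto (fun ε : 𝕜 => ∏ a, ε⁻¹ • (q a (y + ε • v) - q a y)) (𝓝[≠] 0)
      (𝓝 (∏ a, l a v)) :=
    tendsto_finsetProd _ fun a _ =>
      hasLineDerivAt_iff_tendsto_slope_zero.1 ((hq a).hasLineDerivAt v)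
  refine ((hu.tendsto.comp (tendsto_add_smul_nhdsNE y v)).mul hprod).congr fun ε => ?_
  simp only [hq₀, sub_zero, smul_eq_mul, Finset.prod_mul_distrib, Finset.prod_const,
    Finset.card_univ, Function.comp_apply]
  rw [mul_div_assoc, div_eq_inv_mul, inv_pow]

lemma le_of_tendsto_div_pow {F : 𝕜 → 𝕜} {a b : ℕ} {A B : 𝕜} (hB : B ≠ 0)
    (ha : Tendsto (fun ε => F ε / ε ^ a) (𝓝[≠] 0) (𝓝 A))
    (hb : Tendsto (fun ε => F ε / ε ^ b) (𝓝[≠] 0) (𝓝 B)) : a ≤ b := by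
  by_contra! hlt
  have hpow : Tendsto (fun ε : 𝕜 => ε ^ (a - b)) (𝓝[≠] 0) (𝓝 0) := by
    simpa [Nat.sub_ne_zero_of_lt hlt] using
      ((continuous_pow (M := 𝕜) (a - b)).tendsto 0).mono_left nhdsWithin_le_nhds
  have hzero : Tendsto (fun ε => F ε / ε ^ b) (𝓝[≠] 0) (𝓝 (A * 0)) := by
    refine (ha.mul hpow).congr' ?_
    filter_upwards [self_mem_nhdsWithin] with ε (hε : ε ≠ 0)
    rw [← pow_mul_pow_sub ε hlt.le, div_mul_eq_div_div, div_mul_cancel₀ _ (pow_ne_zero _ hε)]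
  exact hB (by simpa using tendsto_nhds_unique hb hzero)

variable {α β : Type*} [Fintype α] [Fintype β] {q : α → E → 𝕜} {t : β → E → 𝕜}
  {l : α → E →L[𝕜] 𝕜} {τ : β → E →L[𝕜] 𝕜} {w u : E → 𝕜} {y : E}

theorem card_eq_and_mul_prod_apply_eq (hq : ∀ a, HasFDerivAt (q a) (l a) y) (hq₀ : ∀ a, q a y = 0)
    (hl : ∀ a, l a ≠ 0) (ht : ∀ b, HasFDerivAt (t b) (τ b) y) (ht₀ : ∀ b, t b y = 0)
    (hτ : ∀ b, τ b ≠ 0) (hw : ContinuousAt w y) (hw₀ : w y ≠ 0) (hu : ContinuousAt u y)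
    (hu₀ : u y ≠ 0) (h : ∀ᶠ z in 𝓝 y, w z * ∏ a, q a z = u z * ∏ b, t b z) :
    Fintype.card α = Fintype.card β ∧ ∀ v, w y * ∏ a, l a v = u y * ∏ b, τ b v := by
  have hlim (v : E) := tendsto_mul_prod_div_pow hw hq hq₀ v
  have hlim' (v : E) : Tendsto (fun ε : 𝕜 => (w (y + ε • v) * ∏ a, q a (y + ε • v)) /
      ε ^ Fintype.card β) (𝓝[≠] 0) (𝓝 (u y * ∏ b, τ b v)) := by
    refine (tendsto_mul_prod_div_pow hu ht ht₀ v).congr' ?_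
    filter_upwards [(tendsto_add_smul_nhdsNE y v).eventually h] with ε hε
    rw [hε]
  have hcard : Fintype.card α = Fintype.card β := by
    obtain ⟨v, hv⟩ := Module.Dual.exists_forall_ne_zero_of_forall_exists
      (Sum.elim (fun a => (l a : Module.Dual 𝕜 E)) fun b => (τ b : Module.Dual 𝕜 E))
      (Sum.rec (fun a => DFunLike.ne_iff.1 (hl a)) fun b => DFunLike.ne_iff.1 (hτ b))
    have hlv : ∏ a, l a v ≠ 0 := Finset.prod_ne_zero_iff.2 fun a _ => hv (Sum.inl a)
    have hτv : ∏ b, τ b v ≠ 0 := Finset.prod_ne_zero_iff.2 fun b _ => hv (Sum.inr b)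
    exact le_antisymm (le_of_tendsto_div_pow (mul_ne_zero hu₀ hτv) (hlim v) (hlim' v))
      (le_of_tendsto_div_pow (mul_ne_zero hw₀ hlv) (hlim' v) (hlim v))
  exact ⟨hcard, fun v => tendsto_nhds_unique (hlim v) (hcard ▸ hlim' v)⟩

theorem linearIndependent_of_mul_prod_eventuallyEq (hq : ∀ a, HasFDerivAt (q a) (l a) y)
    (hq₀ : ∀ a, q a y = 0) (hl : ∀ a, l a ≠ 0) (ht : ∀ b, HasFDerivAt (t b) (τ b) y)
    (ht₀ : ∀ b, t b y = 0) (hτ : LinearIndependent 𝕜 τ) (hw : ContinuousAt w y) (hw₀ : w y ≠ 0)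
    (hu : ContinuousAt u y) (hu₀ : u y ≠ 0)
    (h : ∀ᶠ z in 𝓝 y, w z * ∏ a, q a z = u z * ∏ b, t b z) : LinearIndependent 𝕜 l := by
  obtain ⟨hcard, hform⟩ :=
    card_eq_and_mul_prod_apply_eq hq hq₀ hl ht ht₀ hτ.ne_zero hw hw₀ hu hu₀ h
  have hker : LinearMap.ker (ContinuousLinearMap.coeLM 𝕜 : (E →L[𝕜] 𝕜) →ₗ[𝕜] (E →ₗ[𝕜] 𝕜)) = ⊥ :=
    LinearMap.ker_eq_bot.2 ContinuousLinearMap.coe_injective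
  refine LinearIndependent.of_comp (ContinuousLinearMap.coeLM 𝕜)
    (linearIndependent_of_forall_exists_apply_eq_zero (hτ.map' _ hker)
      (fun a h₀ => hl a (ContinuousLinearMap.coe_injective h₀)) hcard.le fun b v hv => ?_)
  have hprod : w y * ∏ a, l a v = 0 := by
    rw [hform, Finset.prod_eq_zero (Finset.mem_univ b) hv, mul_zero]
  simpa [Finset.prod_eq_zero_iff, hw₀] using hprod

end LeadingForm

section CommonZeros

lemma eval_smul_of_isHomogeneous {σ R : Type*} [CommSemiring R] {g : MvPolynomial σ R} {e : ℕ}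
    (hg : g.IsHomogeneous e) (c : R) (p : σ → R) : eval (c • p) g = c ^ e * eval p g := by
  rw [eval_eq, eval_eq, Finset.mul_sum]
  refine Finset.sum_congr rfl fun d hd => ?_
  have hde : ∑ i ∈ d.support, d i = e := by
    rw [← Finsupp.degree_apply, Finsupp.degree_eq_weight_one]
    exact hg (mem_support_iff.1 hd)
  simp only [Pi.smul_apply, smul_eq_mul, mul_pow, Finset.prod_mul_distrib,
    Finset.prod_pow_eq_pow_sum, hde]
  ring

lemma hasFDerivAt_eval {σ 𝕜 : Type*} [Fintype σ] [NontriviallyNormedField 𝕜]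
    (g : MvPolynomial σ 𝕜) (p : σ → 𝕜) :
    HasFDerivAt (fun z : σ → 𝕜 => eval z g)
      (∑ i, eval p (pderiv i g) • (ContinuousLinearMap.proj i : (σ → 𝕜) →L[𝕜] 𝕜)) p := by
  classical
  induction g using MvPolynomial.induction_on with
  | C a =>
    simp only [eval_C]
    refine (hasFDerivAt_const (𝕜 := 𝕜) a p).congr_fderiv (ContinuousLinearMap.ext fun v => ?_)
    simp
  | add f g hf hg =>
    simp only [map_add]
    refine (hf.fun_add hg).congr_fderiv (ContinuousLinearMap.ext fun v => ?_)
    simp [add_mul, Finset.sum_add_distrib]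
  | mul_X f j hf =>
    have hX : HasFDerivAt (fun z : σ → 𝕜 => z j)
        (ContinuousLinearMap.proj j : (σ → 𝕜) →L[𝕜] 𝕜) p := hasFDerivAt_apply j p
    simp only [eval_mul, eval_X]
    refine (hf.fun_mul hX).congr_fderiv (ContinuousLinearMap.ext fun v => ?_)
    simp [pderiv_X, Pi.single_apply, add_mul, Finset.sum_add_distrib, Finset.mul_sum, apply_ite,
      mul_assoc]

variable {n e : ℕ}

lemma IsNormalCrossingAt.linearIndependent_option {G : (Fin n → ℂ) → ℂ} {y : Fin n → ℂ}
    {L : (Fin n → ℂ) →L[ℂ] ℂ} (hnc : IsNormalCrossingAt (fun z => (∏ j, z j) * G z) y)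
    (hG : HasFDerivAt G L y) (hL : L ≠ 0) (hGy : G y = 0) :
    LinearIndependent ℂ fun a : Option {j // y j = 0} =>
      a.elim L fun j => (ContinuousLinearMap.proj j.1 : (Fin n → ℂ) →L[ℂ] ℂ) := by
  obtain ⟨t, s, u, ⟨hta, ht₀, hτ⟩, hua, hu₀, hF⟩ := hnc
  refine linearIndependent_of_mul_prod_eventuallyEq (y := y)
    (q := fun a : Option {j // y j = 0} => a.elim G fun j z => z j) (t := fun b : s => t b)
    (w := fun z => ∏ j : {j // ¬ y j = 0}, z j) ?_ ?_ ?_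
    (fun b => (hta b).differentiableAt.hasFDerivAt) (fun b => ht₀ b)
    (hτ.comp _ Subtype.val_injective) (Continuous.continuousAt (by fun_prop))
    (Finset.prod_ne_zero_iff.2 fun j _ => j.2) hua.continuousAt hu₀ ?_
  · rintro (_ | j)
    · exact hG
    · exact hasFDerivAt_apply j.1 y
  · rintro (_ | j)
    · exact hGy
    · exact j.2
  · rintro (_ | j)
    · exact hL
    · exact DFunLike.ne_iff.2 ⟨Pi.single j.1 1, by simp⟩
  · filter_upwards [hF] with z hz
    rw [Finset.prod_coe_sort s fun b => t b z, ← hz, Fintype.prod_option,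
      ← Fintype.prod_subtype_mul_prod_subtype (fun j => y j = 0)]
    simp only [Option.elim]
    ring

lemma IsNormalCrossingAt.exists_ne_zero {G : (Fin n → ℂ) → ℂ} {y : Fin n → ℂ}
    {L : (Fin n → ℂ) →L[ℂ] ℂ} (hnc : IsNormalCrossingAt (fun z => (∏ j, z j) * G z) y)
    (hG : HasFDerivAt G L y) (hL : L ≠ 0) (hGy : G y = 0) :
    ∃ j, y j ≠ 0 ∧ L (Pi.single j 1) ≠ 0 := by
  by_contra! hy
  have hLsum : L = ∑ j : {j // y j = 0},
      L (Pi.single j.1 1) • (ContinuousLinearMap.proj j.1 : (Fin n → ℂ) →L[ℂ] ℂ) := by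
    ext v
    have hv : v = ∑ j, v j • Pi.single j (1 : ℂ) := by simpa using pi_eq_sum_univ' v
    conv_lhs => rw [hv, map_sum, ← Fintype.sum_subtype_add_sum_subtype (fun j => y j = 0)]
    have hrest : ∑ j : {j // ¬ y j = 0}, L (v j • Pi.single j.1 1) = 0 :=
      Fintype.sum_eq_zero _ fun j => by rw [map_smul, hy j j.2, smul_zero]
    rw [hrest, add_zero]
    simp [mul_comm]
  have hrel := Fintype.linearIndependent_iff.1 (hnc.linearIndependent_option hG hL hGy)
    (fun a => a.elim (-1) fun j => L (Pi.single j.1 1))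
    (by simp [Fintype.sum_option, ← hLsum]) none
  simp at hrel

variable {g : MvPolynomial (Fin (n + 1)) ℂ}

lemma gPrime_isHomogeneous (hg : g.IsHomogeneous e) (he : 0 < e) (i : Fin (n + 1)) :
    (gPrime g i).IsHomogeneous e := by
  refine IsHomogeneous.add ?_ hg
  simpa only [Nat.add_sub_cancel' he] using! (isHomogeneous_X ℂ i).mul (hg.pderiv (i := i))

lemma sum_gPrime (hg : g.IsHomogeneous e) : ∑ i, gPrime g i = (e + (n + 1)) • g := by
  simp only [gPrime, Finset.sum_add_distrib, hg.sum_X_mul_pderiv, Finset.sum_const,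
    Finset.card_univ, Fintype.card_fin, add_smul]

lemma hasFDerivAt_affineChart (g : MvPolynomial (Fin (n + 1)) ℂ) (k : Fin (n + 1))
    (y : Fin n → ℂ) :
    HasFDerivAt (affineChart g k)
      (∑ j, eval (k.insertNth 1 y : Fin (n + 1) → ℂ) (pderiv (k.succAbove j) g) •
        (ContinuousLinearMap.proj j : (Fin n → ℂ) →L[ℂ] ℂ)) y := by
  have hinsert : HasFDerivAt (fun z : Fin n → ℂ => (k.insertNth 1 z : Fin (n + 1) → ℂ))
      (ContinuousLinearMap.pi (k.insertNth 0 fun j =>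
        (ContinuousLinearMap.proj j : (Fin n → ℂ) →L[ℂ] ℂ))) y := by
    rw [hasFDerivAt_pi']
    intro i
    cases i using k.succAboveCases with
    | x => simpa using hasFDerivAt_const (1 : ℂ) y
    | p j => simpa using hasFDerivAt_apply j y
  convert! (hasFDerivAt_eval g (k.insertNth 1 y)).comp y hinsert using 1
  ext v
  simp [Fin.sum_univ_succAbove _ k]

lemma affineChart_prod_X_mul (g : MvPolynomial (Fin (n + 1)) ℂ) (k : Fin (n + 1)) :
    affineChart ((∏ i, X i) * g) k = fun z => (∏ j, z j) * affineChart g k z := by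
  funext z
  simp [affineChart, Fin.prod_univ_succAbove _ k]

lemma exists_eval_gPrime_ne_zero (hg : g.IsHomogeneous e) (hsmooth : IsSmoothHypersurface g)
    (hnc : IsNormalCrossingDivisor ((∏ i, X i) * g)) (k : Fin (n + 1)) (y : Fin n → ℂ) :
    ∃ i, eval (k.insertNth 1 y : Fin (n + 1) → ℂ) (gPrime g i) ≠ 0 := by
  by_contra! h
  set p : Fin (n + 1) → ℂ := k.insertNth 1 y with hp
  have hpk : p k = 1 := by simp [hp]
  have hgp : eval p g = 0 := by
    have hsum : ((e + (n + 1) : ℕ) : ℂ) * eval p g = 0 := by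
      rw [← nsmul_eq_mul, ← map_nsmul, ← sum_gPrime hg, map_sum, Finset.sum_eq_zero fun i _ => h i]
    exact (mul_eq_zero.1 hsum).resolve_left (Nat.cast_ne_zero.2 (by omega))
  have hpg (i : Fin (n + 1)) : p i * eval p (pderiv i g) = 0 := by
    simpa [gPrime, hgp] using h i
  obtain ⟨i, hi⟩ := hsmooth p (fun hp₀ => by simp [hp₀] at hpk) hgp
  have hik : i ≠ k := by
    rintro rfl
    exact hi (by simpa [hpk] using hpg i)
  obtain ⟨j₀, rfl⟩ := Fin.exists_succAbove_eq hik
  have hchart : affineChart g k y = 0 := hgp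
  have hcross := hnc k y (by simp [affineChart_prod_X_mul, hchart])
  rw [affineChart_prod_X_mul] at hcross
  obtain ⟨j, hyj, hj⟩ := hcross.exists_ne_zero (hasFDerivAt_affineChart g k y)
    (DFunLike.ne_iff.2 ⟨Pi.single j₀ 1, by simpa [Pi.single_apply] using hi⟩) hchart
  have hpj : p (k.succAbove j) ≠ 0 := by simpa [hp] using hyj
  exact hj (by simpa [Pi.single_apply] using (mul_eq_zero.1 (hpg (k.succAbove j))).resolve_left hpj)

theorem eq_zero_of_eval_gPrime_eq_zero (hg : g.IsHomogeneous e) (he : 0 < e)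
    (hsmooth : IsSmoothHypersurface g) (hnc : IsNormalCrossingDivisor ((∏ i, X i) * g))
    (p : Fin (n + 1) → ℂ) (h : ∀ i, eval p (gPrime g i) = 0) : p = 0 := by
  by_contra hp
  obtain ⟨k, hk : p k ≠ 0⟩ := Function.ne_iff.1 hp
  have hscale : (k.insertNth 1 (k.removeNth ((p k)⁻¹ • p)) : Fin (n + 1) → ℂ) = (p k)⁻¹ • p := by
    conv_rhs => rw [← Fin.insertNth_self_removeNth k ((p k)⁻¹ • p)]
    simp [hk]
  obtain ⟨i, hi⟩ :=
    exists_eval_gPrime_ne_zero hg hsmooth hnc k (k.removeNth ((p k)⁻¹ • p))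
  rw [hscale, eval_smul_of_isHomogeneous (gPrime_isHomogeneous hg he i), h, mul_zero] at hi
  exact hi rfl

end CommonZeros

section MinimalGenerators

variable {R σ κ ι : Type*} [CommSemiring R] {d : ℕ}

lemma homogeneousComponent_mul_of_isHomogeneous {q : MvPolynomial σ R} (hq : q.IsHomogeneous d)
    (s : MvPolynomial σ R) : homogeneousComponent d (s * q) = constantCoeff s • q := by
  let := gradedAlgebra (σ := σ) (R := R)
  have hdecomp := DirectSum.coe_decompose_mul_of_right_mem_of_le (homogeneousSubmodule σ R)
    (a := s) (show q ∈ homogeneousSubmodule σ R d from hq) le_rfl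
  rw [← decomposition.decompose'_apply]
  refine hdecomp.trans ?_
  rw [Nat.sub_self]
  refine (congrArg (· * q) (decomposition.decompose'_apply s 0)).trans ?_
  rw [homogeneousComponent_zero, smul_eq_C_mul, constantCoeff_eq]

/-- The part of degree `d` of a vector of polynomials. -/
def degreePart (R : Type*) [CommSemiring R] (σ κ : Type*) (d : ℕ) :
    (κ → MvPolynomial σ R) →ₗ[R] κ → MvPolynomial σ R :=
  (homogeneousComponent d).compLeft κ

variable {ρ : ι → κ → MvPolynomial σ R}

lemma degreePart_smul_apply (hρ : ∀ i k, (ρ i k).IsHomogeneous d) (s : MvPolynomial σ R) (i : ι) :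
    degreePart R σ κ d (s • ρ i) = constantCoeff s • ρ i :=
  funext fun k => homogeneousComponent_mul_of_isHomogeneous (hρ i k) s

lemma degreePart_apply (hρ : ∀ i k, (ρ i k).IsHomogeneous d) (i : ι) :
    degreePart R σ κ d (ρ i) = ρ i := by
  simpa using degreePart_smul_apply hρ 1 i

lemma degreePart_smul_of_mem_span (hρ : ∀ i k, (ρ i k).IsHomogeneous d)
    {x : κ → MvPolynomial σ R} (hx : x ∈ Submodule.span (MvPolynomial σ R) (Set.range ρ))
    (s : MvPolynomial σ R) :
    degreePart R σ κ d (s • x) = constantCoeff s • degreePart R σ κ d x := by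
  induction hx using Submodule.span_induction generalizing s with
  | mem x hx =>
    obtain ⟨i, rfl⟩ := hx
    rw [degreePart_smul_apply hρ, degreePart_apply hρ]
  | zero => simp
  | add x y _ _ hx hy => simp only [smul_add, map_add, hx, hy]
  | smul a x _ hx => rw [smul_smul, hx, hx, map_mul, mul_smul]

lemma degreePart_mem_span_image (hρ : ∀ i k, (ρ i k).IsHomogeneous d)
    {T : Set (κ → MvPolynomial σ R)}
    (hT : T ⊆ Submodule.span (MvPolynomial σ R) (Set.range ρ)) {x : κ → MvPolynomial σ R}
    (hx : x ∈ Submodule.span (MvPolynomial σ R) T) :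
    degreePart R σ κ d x ∈ Submodule.span R (degreePart R σ κ d '' T) := by
  induction hx using Submodule.span_induction with
  | mem x hx => exact Submodule.subset_span ⟨x, hx, rfl⟩
  | zero => simp
  | add x y _ _ hx hy => simpa only [map_add] using add_mem hx hy
  | smul a x hx hφx =>
    rw [degreePart_smul_of_mem_span hρ (Submodule.span_le.2 hT hx)]
    exact Submodule.smul_mem _ _ hφx

variable {K : Type*} [Field K] {ρ : ι → κ → MvPolynomial σ K}

lemma card_le_ncard_of_span_eq_span_range [Fintype ι] (hρ : ∀ i k, (ρ i k).IsHomogeneous d)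
    (hli : LinearIndependent K ρ) {T : Set (κ → MvPolynomial σ K)} (hTfin : T.Finite)
    (hT : Submodule.span (MvPolynomial σ K) T =
      Submodule.span (MvPolynomial σ K) (Set.range ρ)) : Fintype.card ι ≤ T.ncard := by
  have hle : Submodule.span K (Set.range ρ) ≤ Submodule.span K (degreePart K σ κ d '' T) := by
    rw [Submodule.span_le]
    rintro _ ⟨i, rfl⟩
    rw [SetLike.mem_coe, ← degreePart_apply hρ i]
    exact degreePart_mem_span_image hρ (hT ▸ Submodule.subset_span)
      (hT ▸ Submodule.subset_span ⟨i, rfl⟩)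
  have := (hTfin.image (degreePart K σ κ d)).fintype
  have : FiniteDimensional K (Submodule.span K (degreePart K σ κ d '' T)) :=
    FiniteDimensional.span_of_finite K (Set.toFinite _)
  calc Fintype.card ι = Module.finrank K (Submodule.span K (Set.range ρ)) :=
      (finrank_span_eq_card hli).symm
    _ ≤ Module.finrank K (Submodule.span K (degreePart K σ κ d '' T)) :=
      Submodule.finrank_mono hle
    _ ≤ (degreePart K σ κ d '' T).ncard := by
      rw [Set.ncard_eq_toFinset_card']
      exact finrank_span_le_card _
    _ ≤ T.ncard := Set.ncard_image_le hTfin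

theorem spanFinrank_span_range_eq_card [Fintype ι] (hρ : ∀ i k, (ρ i k).IsHomogeneous d)
    (hli : LinearIndependent K ρ) :
    (Submodule.span (MvPolynomial σ K) (Set.range ρ)).spanFinrank = Fintype.card ι := by
  refine le_antisymm ?_ ?_
  · calc (Submodule.span (MvPolynomial σ K) (Set.range ρ)).spanFinrank
      _ ≤ (Set.range ρ).ncard :=
        Submodule.spanFinrank_span_le_ncard_of_finite (Set.finite_range ρ)
      _ = Fintype.card ι := by
        rw [Set.ncard_range_of_injective hli.injective, Nat.card_eq_fintype_card]
  · obtain ⟨T, hTcard, hT⟩ := Submodule.FG.exists_span_finset_card_eq_spanFinrank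
      (Submodule.fg_span (R := MvPolynomial σ K) (Set.finite_range ρ))
    rw [← hTcard, ← Set.ncard_coe_finset]
    exact card_le_ncard_of_span_eq_span_range hρ hli T.finite_toSet hT

theorem isMinimalGenerators_range [Finite ι] (hρ : ∀ i k, (ρ i k).IsHomogeneous d)
    (hli : LinearIndependent K ρ) :
    IsMinimalGenerators (Set.range ρ) (Submodule.span (MvPolynomial σ K) (Set.range ρ)) := by
  have := Fintype.ofFinite ι
  refine ⟨rfl, fun Y hY hYρ => ?_⟩
  have hfin := Set.finite_range ρ
  refine (Set.eq_of_subset_of_ncard_le hYρ ?_ hfin).ge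
  rw [Set.ncard_range_of_injective hli.injective, Nat.card_eq_fintype_card]
  exact card_le_ncard_of_span_eq_span_range hρ hli (hfin.subset hYρ) hY

end MinimalGenerators

section RhoPrime

variable {n e : ℕ} {g : MvPolynomial (Fin (n + 1)) ℂ}

/-- Multiplication of the `j`-th component by `x_j`, which carries the syzygies of the `g'_j` to
Jacobian syzygies of `x_0 ⋯ x_n g`. -/
def mulX (n : ℕ) : (Fin (n + 1) → MvPolynomial (Fin (n + 1)) ℂ) →ₗ[MvPolynomial (Fin (n + 1)) ℂ]
    Fin (n + 1) → MvPolynomial (Fin (n + 1)) ℂ :=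
  LinearMap.pi fun j => (X j : MvPolynomial (Fin (n + 1)) ℂ) • LinearMap.proj j

lemma mulX_apply (b : Fin (n + 1) → MvPolynomial (Fin (n + 1)) ℂ) (j : Fin (n + 1)) :
    mulX n b j = X j * b j :=
  rfl

lemma mulX_injective (n : ℕ) : Function.Injective (mulX n) := by
  intro a b hab
  funext j
  have hj : X j * a j = X j * b j := by simpa only [mulX_apply] using congrFun hab j
  exact mul_left_cancel₀ (X_ne_zero j) hj

lemma mulX_koszulRelation_gPrime {i j : Fin (n + 1)} (hij : i ≠ j) :
    mulX n (koszulRelation (gPrime g) i j 1) = rhoPrime g i j := by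
  funext k
  rw [mulX_apply, koszulRelation, rhoPrime]
  split_ifs with hki hkj
  · simp [hki, hij]
  · simp [hkj, hij.symm]
  · simp [hki, hkj]

lemma pderiv_prod_X_mul (g : MvPolynomial (Fin (n + 1)) ℂ) (j : Fin (n + 1)) :
    pderiv j ((∏ i, X i) * g) = (∏ i ∈ Finset.univ.erase j, X i) * gPrime g j := by
  have hconst : pderiv j (∏ i ∈ Finset.univ.erase j, X i : MvPolynomial (Fin (n + 1)) ℂ) = 0 :=
    pderiv_eq_zero_of_notMem_vars fun hj => by simpa using vars_prod _ hj
  rw [← Finset.mul_prod_erase _ _ (Finset.mem_univ j), pderiv_mul, pderiv_mul, hconst,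
    pderiv_X_self, gPrime]
  ring

lemma mem_D₀_prod_X_mul_iff {a : Fin (n + 1) → MvPolynomial (Fin (n + 1)) ℂ} :
    a ∈ D₀ ((∏ i, X i) * g) ↔
      ∑ j, a j * ((∏ i ∈ Finset.univ.erase j, X i) * gPrime g j) = 0 := by
  simp only [← pderiv_prod_X_mul]
  rfl

lemma mulX_mem_D₀_iff {b : Fin (n + 1) → MvPolynomial (Fin (n + 1)) ℂ} :
    mulX n b ∈ D₀ ((∏ i, X i) * g) ↔ b ∈ syzygies (gPrime g) (MvPolynomial (Fin (n + 1)) ℂ) := by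
  have hterm (j : Fin (n + 1)) :
      mulX n b j * ((∏ i ∈ Finset.univ.erase j, X i) * gPrime g j) =
        (∏ i, X i) * (gPrime g j • b j) := by
    rw [mulX_apply, ← Finset.mul_prod_erase _ _ (Finset.mem_univ j), smul_eq_mul]
    ring
  rw [mem_D₀_prod_X_mul_iff, mem_syzygies_iff, Finset.sum_congr rfl fun j _ => hterm j,
    ← Finset.mul_sum, mul_eq_zero,
    or_iff_right (Finset.prod_ne_zero_iff.2 fun i _ => X_ne_zero i)]

lemma X_dvd_apply_mul_gPrime {a : Fin (n + 1) → MvPolynomial (Fin (n + 1)) ℂ}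
    (ha : a ∈ D₀ ((∏ i, X i) * g)) (j : Fin (n + 1)) : X j ∣ a j * gPrime g j := by
  rw [mem_D₀_prod_X_mul_iff, ← Finset.add_sum_erase _ _ (Finset.mem_univ j)] at ha
  have hdvd : X j ∣ (∏ i ∈ Finset.univ.erase j, X i) * (a j * gPrime g j) := by
    rw [mul_left_comm, eq_neg_of_add_eq_zero_left ha]
    refine (Finset.dvd_sum fun i hi => ?_).neg_right
    exact ((Finset.dvd_prod_of_mem _ (Finset.mem_erase.2
      ⟨(Finset.ne_of_mem_erase hi).symm, Finset.mem_univ j⟩)).mul_right _).mul_left _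
  refine (X_prime.dvd_or_dvd hdvd).resolve_left fun hprod => ?_
  obtain ⟨i, hi, hji⟩ := (X_prime.dvd_finsetProd_iff _).1 hprod
  exact Finset.ne_of_mem_erase hi (X_dvd_X.1 hji).symm

lemma X_dvd_gPrime_of_X_dvd_gPrime_self {j : Fin (n + 1)} (h : X j ∣ gPrime g j)
    (i : Fin (n + 1)) : X j ∣ gPrime g i := by
  obtain ⟨q, rfl⟩ := (dvd_add_right (Dvd.intro _ rfl)).1 h
  rcases eq_or_ne i j with rfl | hij
  · exact h
  · refine ⟨X i * pderiv i q + q, ?_⟩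
    rw [gPrime, pderiv_mul, pderiv_X_of_ne hij.symm]
    ring

lemma X_dvd_apply_of_mem_D₀ (hz : ∀ p, (∀ i, eval p (gPrime g i) = 0) → p = 0)
    {a : Fin (n + 1) → MvPolynomial (Fin (n + 1)) ℂ} (ha : a ∈ D₀ ((∏ i, X i) * g))
    (j : Fin (n + 1)) : X j ∣ a j := by
  refine (X_prime.dvd_or_dvd (X_dvd_apply_mul_gPrime ha j)).elim id fun hj => ?_
  have hsub (k : Fin (n + 1)) : k = j := by
    by_contra hkj
    have hk : (Pi.single k 1 : Fin (n + 1) → ℂ) = 0 := hz _ fun i => by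
      obtain ⟨q, hq⟩ := X_dvd_gPrime_of_X_dvd_gPrime_self hj i
      simp [hq, Ne.symm hkj]
    simpa using congrFun hk k
  -- Only the case of a single variable is left, where `D₀` is zero.
  have hgj : gPrime g j ≠ 0 := fun hgj => by
    have hj : (Pi.single j 1 : Fin (n + 1) → ℂ) = 0 := hz _ fun i => by simp [hsub i, hgj]
    simpa using congrFun hj j
  have huniv : (Finset.univ : Finset (Fin (n + 1))) = {j} :=
    Finset.eq_singleton_iff_unique_mem.2 ⟨Finset.mem_univ j, fun k _ => hsub k⟩
  rw [mem_D₀_prod_X_mul_iff, huniv] at ha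
  have haj : a j = 0 := by simpa [hgj] using ha
  exact haj ▸ dvd_zero _

lemma map_mulX_syzygies_gPrime (hz : ∀ p, (∀ i, eval p (gPrime g i) = 0) → p = 0) :
    (syzygies (gPrime g) (MvPolynomial (Fin (n + 1)) ℂ)).map (mulX n) = D₀ ((∏ i, X i) * g) := by
  refine le_antisymm ?_ ?_
  · rintro _ ⟨b, hb, rfl⟩
    exact mulX_mem_D₀_iff.2 hb
  · intro a ha
    choose b hb using X_dvd_apply_of_mem_D₀ hz ha
    have hab : mulX n b = a := by
      funext j
      rw [mulX_apply, hb j]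
    exact ⟨b, mulX_mem_D₀_iff.1 (by rwa [hab]), hab⟩

/-- The family of the `ρ'_{ij}` with `i < j`. -/
def rhoFamily (g : MvPolynomial (Fin (n + 1)) ℂ)
    (p : {p : Fin (n + 1) × Fin (n + 1) // p.1 < p.2}) :
    Fin (n + 1) → MvPolynomial (Fin (n + 1)) ℂ :=
  rhoPrime g p.1.1 p.1.2

lemma range_rhoFamily (g : MvPolynomial (Fin (n + 1)) ℂ) :
    Set.range (rhoFamily g) = {ρ | ∃ i j : Fin (n + 1), i < j ∧ ρ = rhoPrime g i j} := by
  ext ρ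
  simp [rhoFamily, eq_comm]

lemma mulX_comp_koszulRelation_gPrime (g : MvPolynomial (Fin (n + 1)) ℂ) :
    (mulX n ∘ fun p : {p : Fin (n + 1) × Fin (n + 1) // p.1 < p.2} =>
      koszulRelation (gPrime g) p.1.1 p.1.2 1) = rhoFamily g :=
  funext fun p => mulX_koszulRelation_gPrime p.2.ne

theorem span_range_rhoFamily (hz : ∀ p, (∀ i, eval p (gPrime g i) = 0) → p = 0) :
    Submodule.span (MvPolynomial (Fin (n + 1)) ℂ) (Set.range (rhoFamily g)) =
      D₀ ((∏ i, X i) * g) := by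
  rw [← map_mulX_syzygies_gPrime hz, syzygies_eq_koszulSubmodule_of_eval_eq_zero _ hz,
    koszulSubmodule_eq_span_range, Submodule.map_span, ← Set.range_comp,
    mulX_comp_koszulRelation_gPrime]

lemma linearIndependent_gPrime (hg : g.IsHomogeneous e) (he : 0 < e)
    (hz : ∀ p, (∀ i, eval p (gPrime g i) = 0) → p = 0) : LinearIndependent ℂ (gPrime g) :=
  linearIndependent_of_syzygies_eq_koszulSubmodule (RingHom.ker_ne_top constantCoeff)
    (fun i => (gPrime_isHomogeneous hg he i).coeff_eq_zero (by simpa using he.ne))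
    (syzygies_eq_koszulSubmodule_of_eval_eq_zero _ hz)

theorem linearIndependent_rhoFamily (hg : g.IsHomogeneous e) (he : 0 < e)
    (hz : ∀ p, (∀ i, eval p (gPrime g i) = 0) → p = 0) : LinearIndependent ℂ (rhoFamily g) := by
  rw [← mulX_comp_koszulRelation_gPrime]
  exact (linearIndependent_koszulRelation (linearIndependent_gPrime hg he hz)).map'
    ((mulX n).restrictScalars ℂ) (LinearMap.ker_eq_bot.2 (mulX_injective n))

lemma rhoPrime_isHomogeneous (hg : g.IsHomogeneous e) (he : 0 < e) (i j k : Fin (n + 1)) :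
    (rhoPrime g i j k).IsHomogeneous (e + 1) := by
  have hmul (i j : Fin (n + 1)) : (X i * gPrime g j).IsHomogeneous (e + 1) :=
    add_comm e 1 ▸ (isHomogeneous_X ℂ i).mul (gPrime_isHomogeneous hg he j)
  unfold rhoPrime
  split_ifs
  exacts [hmul i j, (hmul j i).neg, isHomogeneous_zero _ _ _]

lemma rhoPrime_apply_ne_zero_iff (h₀ : ∀ i, gPrime g i ≠ 0) (i j k : Fin (n + 1)) :
    rhoPrime g i j k ≠ 0 ↔ k = i ∨ k = j := by
  unfold rhoPrime
  split_ifs with hi hj <;> simp_all [X_ne_zero]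

lemma card_subtype_fst_lt_snd {α : Type*} [Fintype α] [LinearOrder α] :
    Fintype.card {p : α × α // p.1 < p.2} = (Fintype.card α).choose 2 := by
  rw [Fintype.card_subtype, ← Finset.univ_product_univ, Finset.card_product_filter_lt,
    Finset.card_univ]

end RhoPrime

end JacobianSyzygies

end

theorem corollary1p2_general {n e : ℕ} (he : 0 < e) {g : MvPolynomial (Fin (n + 1)) ℂ}
    (hg : g.IsHomogeneous e)
    (hz : ∀ p, (∀ i, MvPolynomial.eval p (JacobianSyzygies.gPrime g i) = 0) → p = 0) :
    (∀ i j : Fin (n + 1), i < j →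
      (∀ k, (JacobianSyzygies.rhoPrime g i j k).IsHomogeneous (e + 1)) ∧
      (∀ k, JacobianSyzygies.rhoPrime g i j k ≠ 0 ↔ k = i ∨ k = j)) ∧
    JacobianSyzygies.IsMinimalGenerators
      {ρ | ∃ i j : Fin (n + 1), i < j ∧ ρ = JacobianSyzygies.rhoPrime g i j}
      (JacobianSyzygies.D₀ ((∏ i, MvPolynomial.X i) * g)) ∧
    {ρ | ∃ i j : Fin (n + 1), i < j ∧ ρ = JacobianSyzygies.rhoPrime g i j}.ncard =
      (n + 1).choose 2 ∧
    (JacobianSyzygies.D₀ ((∏ i, MvPolynomial.X i) * g)).spanFinrank = (n + 1).choose 2 := by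
  open JacobianSyzygies in
  have hhom (p) (k : Fin (n + 1)) : (rhoFamily g p k).IsHomogeneous (e + 1) :=
    rhoPrime_isHomogeneous hg he p.1.1 p.1.2 k
  have hli := linearIndependent_rhoFamily hg he hz
  have hcard : Fintype.card {p : Fin (n + 1) × Fin (n + 1) // p.1 < p.2} = (n + 1).choose 2 := by
    rw [card_subtype_fst_lt_snd, Fintype.card_fin]
  rw [← range_rhoFamily, ← span_range_rhoFamily hz, ← hcard]
  refine ⟨fun i j _ => ⟨rhoPrime_isHomogeneous hg he i j,
    rhoPrime_apply_ne_zero_iff (linearIndependent_gPrime hg he hz).ne_zero i j⟩,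
    isMinimalGenerators_range hhom hli, ?_, spanFinrank_span_range_eq_card hhom hli⟩
  rw [Set.ncard_range_of_injective hli.injective, Nat.card_eq_fintype_card]

theorem corollary1p2 (n e : ℕ) (hn : 2 ≤ n) (he : 0 < e)
    (g f : MvPolynomial (Fin (n + 1)) ℂ) (hg : g.IsHomogeneous e)
    (hsmooth : JacobianSyzygies.IsSmoothHypersurface g)
    (hf : f = (∏ i, MvPolynomial.X i) * g)
    (hnc : JacobianSyzygies.IsNormalCrossingDivisor f) :
    (∀ i j : Fin (n + 1), i < j →
      (∀ k, (JacobianSyzygies.rhoPrime g i j k).IsHomogeneous (e + 1)) ∧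
      (∀ k, JacobianSyzygies.rhoPrime g i j k ≠ 0 ↔ k = i ∨ k = j)) ∧
    JacobianSyzygies.IsMinimalGenerators
      {ρ | ∃ i j : Fin (n + 1), i < j ∧ ρ = JacobianSyzygies.rhoPrime g i j}
      (JacobianSyzygies.D₀ f) ∧
    {ρ | ∃ i j : Fin (n + 1), i < j ∧ ρ = JacobianSyzygies.rhoPrime g i j}.ncard =
      (n + 1).choose 2 ∧
    (JacobianSyzygies.D₀ f).spanFinrank = (n + 1).choose 2 := by
  subst hf
  exact corollary1p2_general he hg
    (JacobianSyzygies.eq_zero_of_eval_gPrime_eq_zero hg he hsmooth hnc)
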